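/- Let $p\ge 2$ be an integer and let $k,m\ge 0$ be integers with $k\ge m-1$. Then $(1-z)^{-1/p}$ (principal branch) has a unique Padé approximant $[k/m]$ at $0$, that is, there is exactly one pair of complex polynomials $P_{km},Q_{km}$ without common zeros such that $\deg P_{km}\le k$, $\deg Q_{km}\le m$, $Q_{km}(0)=1$ and $$(1-z)^{-1/p}-\frac{P_{km}(z)}{Q_{km}(z)}=O(z^{k+m+1})\quad\text{as } z\to 0.$$ Let $x_0\in\mathbb{C}$ satisfy $|1-x_0^p|<1$. Then the Padé iteration $$x_{l+1}=x_l\,\frac{P_{km}(1-x_l^p)}{Q_{km}(1-x_l^p)},\qquad l=0,1,2,\dots,$$ is well defined, i.e. $Q_{km}(1-x_l^p)\ne 0$ for all $l\ge 0$, and $$|1-x_l^p|\le|1-x_0^p|^{(k+m+1)^l}\qquad\text{for every } l\ge 0.$$ -/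

import Mathlib

open Polynomial Asymptotics Topology

/-- `P / Q` is the (reduced, normalized) Padé approximant `[k/m]` of `f` at `0`: `deg P ≤ k`,
`deg Q ≤ m`, `Q(0) = 1`, `P` and `Q` have no common zero, and
`f(z) - P(z)/Q(z) = O(z^(k+m+1))` as `z → 0`. -/
structure IsPadeApproximant (f : ℂ → ℂ) (k m : ℕ) (P Q : ℂ[X]) : Prop where
  natDegree_num_le : P.natDegree ≤ k
  natDegree_den_le : Q.natDegree ≤ m
  den_eval_zero : Q.eval 0 = 1
  no_common_zero : ∀ z : ℂ, ¬ (P.eval z = 0 ∧ Q.eval z = 0)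
  isBigO : (fun z : ℂ => f z - P.eval z / Q.eval z) =O[𝓝 0] (fun z : ℂ => z ^ (k + m + 1))

/-- The function `z ↦ (1 - z)^(-1/p)`, with the principal branch of the power. -/
noncomputable def invRoot (p : ℕ) (z : ℂ) : ℂ := (1 - z) ^ (-(1 / (p : ℂ)))

/-- The iteration function `h(x) = x P(1 - x^p) / Q(1 - x^p)`. -/
noncomputable def padeStep (p : ℕ) (P Q : ℂ[X]) (x : ℂ) : ℂ :=
  x * (P.eval (1 - x ^ p) / Q.eval (1 - x ^ p))

/-! Put a = 1/p, N = k + m, P = ₂F₁(-k, a-m; -N; z), Q = ₂F₁(-m, -a-k; -N; z), r = P/Q. Everything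
rests on the identity aPQ - (1-z)(P'Q - PQ') = c z^N with c > 0 (`exists_padeWronskian_eq`), whose
left side is Q²(a r - (1-z) r'). By it, the derivative of (1-z)^a r vanishes to order N at 0, which
gives the order of contact (`isBigO_invRoot_sub`), and a common zero of P and Q could only be 0,
where Q = 1. Uniqueness is a degree count.

For the contraction, 1 - x_{l+1}^p = g(1 - x_l^p) with g(z) = 1 - (1-z) r(z)^p, and the identity
gives g' = p c z^N r^(p-1) / Q². If r and 1/Q have nonnegative Taylor coefficients, so does g, whose
series starts at z^(N+1) or later. Since g ≤ 1 on (0,1), it follows that |g(z)| ≤ |z|^(N+1)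
(`norm_residual_le`). Positivity enters through `NormMajorized`, a form of it that avoids power
series on the disc.

The zeros of Q lie in (1,∞) by a Rodrigues formula and Rolle's theorem (`exists_factorization_den`),
which settles 1/Q. For r, the coefficients below z^(k+1-m) obey the recursion of (1-z)^(-a), and the
rest is z^(k+1-m) times simple fractions whose weights get their sign from the identity at the zeros
of Q (`exists_stieltjes_decomposition`). -/

/-! ### Terminating hypergeometric polynomials and their differential equation -/

/-- The ratio of falling factorials `(-1)^i x(x-1)⋯(x-i+1) / (N(N-1)⋯(N-i+1))`. -/
noncomputable def fallingRatio (N : ℕ) (x : ℝ) (i : ℕ) : ℝ :=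
  ∏ l ∈ Finset.range i, (((l : ℝ) - x) / ((N : ℝ) - l))

/-- The terminating hypergeometric polynomial `₂F₁(-j, -x; -N; X)`. -/
noncomputable def hypPoly (N : ℕ) (x : ℝ) (j : ℕ) : ℝ[X] :=
  ∑ i ∈ Finset.range (j + 1), monomial i ((j.choose i : ℝ) * fallingRatio N x i)

lemma fallingRatio_zero (N : ℕ) (x : ℝ) : fallingRatio N x 0 = 1 := by simp [fallingRatio]

lemma fallingRatio_succ (N : ℕ) (x : ℝ) {i : ℕ} (hi : i < N) :
    ((N : ℝ) - i) * fallingRatio N x (i + 1) = ((i : ℝ) - x) * fallingRatio N x i := by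
  have h : (N : ℝ) - i ≠ 0 := sub_ne_zero.2 (by exact_mod_cast hi.ne')
  rw [fallingRatio, Finset.prod_range_succ, ← fallingRatio]
  field_simp

lemma coeff_hypPoly (N : ℕ) (x : ℝ) (j i : ℕ) :
    (hypPoly N x j).coeff i = (j.choose i : ℝ) * fallingRatio N x i := by
  rw [hypPoly, finsetSum_coeff]
  simp only [coeff_monomial]
  rw [Finset.sum_ite_eq' (Finset.range (j + 1)) i]
  split_ifs with h
  · rfl
  · rw [Nat.choose_eq_zero_of_lt (by simpa using h)]; simp

lemma natDegree_hypPoly_le (N : ℕ) (x : ℝ) (j : ℕ) : (hypPoly N x j).natDegree ≤ j := by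
  rw [natDegree_le_iff_coeff_eq_zero]
  intro i hi
  rw [coeff_hypPoly, Nat.choose_eq_zero_of_lt hi]; simp

lemma eval_zero_hypPoly (N : ℕ) (x : ℝ) (j : ℕ) : (hypPoly N x j).eval 0 = 1 := by
  rw [← coeff_zero_eq_eval_zero, coeff_hypPoly, fallingRatio_zero]; simp

lemma cast_succ_mul_choose_succ (j n : ℕ) :
    ((n : ℝ) + 1) * (j.choose (n + 1) : ℝ) = ((j : ℝ) - n) * (j.choose n : ℝ) := by
  rcases le_or_gt n j with h | h
  · have := Nat.choose_succ_right_eq j n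
    rw [← Nat.cast_sub h, mul_comm ((n : ℝ) + 1), mul_comm (((j - n : ℕ) : ℝ))]
    exact_mod_cast this
  · rw [Nat.choose_eq_zero_of_lt h, Nat.choose_eq_zero_of_lt (by omega)]; simp

/-- The recursion for `fallingRatio` breaks at `n = N`, where a zero denominator enters. As `j ≤ N`,
the binomial factor vanishes there. -/
lemma choose_mul_fallingRatio_succ {N j : ℕ} (x : ℝ) (hj : j ≤ N) (n : ℕ) :
    ((N : ℝ) - n) * ((j.choose (n + 1) : ℝ) * fallingRatio N x (n + 1)) =
      ((n : ℝ) - x) * ((j.choose (n + 1) : ℝ) * fallingRatio N x n) := by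
  rcases lt_or_ge n j with h | h
  · linear_combination (j.choose (n + 1) : ℝ) * fallingRatio_succ N x (h.trans_le hj)
  · rw [Nat.choose_eq_zero_of_lt (by omega)]; simp

lemma coeff_hypPoly_succ {N j : ℕ} (x : ℝ) (hj : j ≤ N) (n : ℕ) :
    ((n : ℝ) + 1) * (n - N) * (hypPoly N x j).coeff (n + 1) =
      ((n : ℝ) - j) * (n - x) * (hypPoly N x j).coeff n := by
  rw [coeff_hypPoly, coeff_hypPoly]
  linear_combination (-((n : ℝ) + 1)) * choose_mul_fallingRatio_succ x hj n -
    ((n : ℝ) - x) * fallingRatio N x n * cast_succ_mul_choose_succ j n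

/-- The hypergeometric differential equation. -/
lemma hypPoly_ode {N j : ℕ} (x : ℝ) (hj : j ≤ N) :
    X * (1 - X) * derivative (derivative (hypPoly N x j)) +
      (-C (N : ℝ) - C (1 - j - x) * X) * derivative (hypPoly N x j) -
      C (j * x) * hypPoly N x j = 0 := by
  set G := hypPoly N x j with hG
  have e : X * (1 - X) * derivative (derivative G) +
      (-C (N : ℝ) - C (1 - j - x) * X) * derivative G - C (j * x) * G =
      X * derivative (derivative G) - X * (X * derivative (derivative G)) -
      C (N : ℝ) * derivative G - C (1 - j - x) * (X * derivative G) - C (j * x) * G := by ring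
  rw [e]
  ext n
  have hr := coeff_hypPoly_succ x hj n
  rw [← hG] at hr
  rcases n with _ | _ | n
  · simp [coeff_derivative] at hr ⊢
    linear_combination hr
  · have hX : ∀ q : ℝ[X], (X * q).coeff 1 = q.coeff 0 := fun q => coeff_X_mul q 0
    simp only [coeff_sub, coeff_C_mul, hX, coeff_X_mul_zero, coeff_derivative, coeff_zero] at hr ⊢
    norm_num at hr ⊢
    linear_combination hr
  · simp only [coeff_sub, coeff_C_mul, coeff_X_mul, coeff_derivative, coeff_zero] at hr ⊢
    push_cast at hr ⊢
    linear_combination hr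

/-! ### The Wronskian identity and the sign of its constant -/

/-- The Wronskian-type combination of the Padé numerator and denominator. -/
noncomputable def padeWronskian (a : ℝ) (P Q : ℝ[X]) : ℝ[X] :=
  C a * (P * Q) - (1 - X) * (derivative P * Q - P * derivative Q)

/-- Differentiation produces X(1-X)(P''Q - PQ''), which the two hypergeometric equations eliminate;
what remains is (k+m) times the Wronskian. -/
lemma X_mul_derivative_padeWronskian (a : ℝ) (k m : ℕ) :
    X * derivative (padeWronskian a (hypPoly (k + m) (m - a) k) (hypPoly (k + m) (k + a) m)) =
      C ((k + m : ℕ) : ℝ) *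
        padeWronskian a (hypPoly (k + m) (m - a) k) (hypPoly (k + m) (k + a) m) := by
  have hP := hypPoly_ode ((m : ℝ) - a) (Nat.le_add_right k m)
  have hQ := hypPoly_ode ((k : ℝ) + a) (Nat.le_add_left m k)
  set P := hypPoly (k + m) (m - a) k
  set Q := hypPoly (k + m) (k + a) m
  rw [padeWronskian]
  simp only [derivative_mul, derivative_C, derivative_one, derivative_X,
    map_sub, map_add, map_mul, map_one, Nat.cast_add] at hP hQ ⊢
  linear_combination (-Q) * hP + P * hQ

lemma coeff_X_mul_derivative (P : ℝ[X]) (n : ℕ) :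
    (X * derivative P).coeff n = (n : ℝ) * P.coeff n := by
  rcases n with _ | n
  · simp
  · rw [coeff_X_mul, coeff_derivative]; push_cast; ring

lemma eq_monomial_of_X_mul_derivative {W : ℝ[X]} {N : ℕ}
    (h : X * derivative W = C (N : ℝ) * W) : W = C (W.coeff N) * X ^ N := by
  ext n
  rw [coeff_C_mul, coeff_X_pow]
  split_ifs with hn
  · rw [hn, mul_one]
  · have h1 := congrArg (fun q => q.coeff n) h
    simp only [coeff_X_mul_derivative, coeff_C_mul] at h1
    have h3 : ((n : ℝ) - N) * W.coeff n = 0 := by linear_combination h1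
    rcases mul_eq_zero.1 h3 with h4 | h4
    · exact absurd (by exact_mod_cast sub_eq_zero.1 h4) hn
    · rw [h4, mul_zero]

/-- The operator X d/dX multiplies the top coefficients by `k` and `m`, whence `k - m`; the part P'Q
- PQ' without the factor X has degree below `k + m`. -/
lemma coeff_padeWronskian {P Q : ℝ[X]} {k m : ℕ} (hP : P.natDegree ≤ k)
    (hQ : Q.natDegree ≤ m) (a : ℝ) :
    (padeWronskian a P Q).coeff (k + m) = (a + k - m) * (P.coeff k * Q.coeff m) := by
  have hXP : (X * derivative P).natDegree ≤ k := by
    rw [natDegree_le_iff_coeff_eq_zero] at hP ⊢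
    intro n hn
    rw [coeff_X_mul_derivative, hP n hn, mul_zero]
  have hXQ : (X * derivative Q).natDegree ≤ m := by
    rw [natDegree_le_iff_coeff_eq_zero] at hQ ⊢
    intro n hn
    rw [coeff_X_mul_derivative, hQ n hn, mul_zero]
  have h0 : (derivative P * Q - P * derivative Q).coeff (k + m) = 0 := by
    have h1 : (X * (derivative P * Q - P * derivative Q)).coeff (k + m + 1) = 0 := by
      have : X * (derivative P * Q - P * derivative Q) =
        (X * derivative P) * Q - P * (X * derivative Q) := by ring
      rw [this]
      refine coeff_eq_zero_of_natDegree_lt ((natDegree_sub_le _ _).trans_lt ?_)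
      refine (max_le (natDegree_mul_le_of_le hXP hQ) (natDegree_mul_le_of_le hP hXQ)).trans_lt ?_
      omega
    rwa [coeff_X_mul] at h1
  have e : padeWronskian a P Q = C a * (P * Q) - (derivative P * Q - P * derivative Q) +
      ((X * derivative P) * Q - P * (X * derivative Q)) := by rw [padeWronskian]; ring
  rw [e, coeff_add, coeff_sub, h0, coeff_C_mul, coeff_sub, coeff_mul_add_eq_of_natDegree_le hP hQ,
    coeff_mul_add_eq_of_natDegree_le hXP hQ, coeff_mul_add_eq_of_natDegree_le hP hXQ,
    coeff_X_mul_derivative, coeff_X_mul_derivative]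
  ring

/-- Sign of a falling ratio, when all its factors are negative. -/
lemma fallingRatio_sign_neg {N : ℕ} {x : ℝ} {n : ℕ} (hn : n ≤ N) (hx : (n : ℝ) < x + 1) :
    0 < (-1 : ℝ) ^ n * fallingRatio N x n := by
  induction n with
  | zero => simp [fallingRatio]
  | succ n ih =>
    have hx' : (n : ℝ) < x := by push_cast at hx; linarith
    have ih := ih (by omega) (by linarith)
    have hN : (n : ℝ) < N := by exact_mod_cast hn
    rw [fallingRatio, Finset.prod_range_succ, ← fallingRatio]
    have : (-1 : ℝ) ^ (n + 1) * (fallingRatio N x n * ((n - x) / (N - n))) =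
      ((-1 : ℝ) ^ n * fallingRatio N x n) * ((x - n) / (N - n)) := by
      rw [pow_succ]; ring
    rw [this]
    exact mul_pos ih (div_pos (by linarith) (by linarith))

/-- The numerators l - m + a are negative for l < m and positive from l = m on. -/
lemma fallingRatio_sign_of_le {N m n : ℕ} {a : ℝ} (ha : 0 < a) (ha1 : a < 1)
    (hmn : m ≤ n) (hn : n ≤ N) : 0 < (-1 : ℝ) ^ m * fallingRatio N (m - a) n := by
  induction n, hmn using Nat.le_induction with
  | base => exact fallingRatio_sign_neg hn (by linarith)
  | succ n hmn ih =>
    have ih := ih (by omega)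
    have hN : (n : ℝ) < N := by exact_mod_cast hn
    have hm : (m : ℝ) ≤ n := by exact_mod_cast hmn
    rw [fallingRatio, Finset.prod_range_succ, ← fallingRatio, ← mul_assoc]
    exact mul_pos ih (div_pos (by linarith) (by linarith))

/-- The Wronskian of the Padé pair is a positive multiple of `X ^ (k + m)`. -/
lemma exists_padeWronskian_eq {a : ℝ} (ha : 0 < a) (ha1 : a < 1) {k m : ℕ} (hkm : m ≤ k + 1) :
    ∃ c : ℝ, 0 < c ∧
      padeWronskian a (hypPoly (k + m) (m - a) k) (hypPoly (k + m) (k + a) m) =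
        C c * X ^ (k + m) := by
  refine ⟨_, ?_, eq_monomial_of_X_mul_derivative (X_mul_derivative_padeWronskian a k m)⟩
  rw [coeff_padeWronskian (natDegree_hypPoly_le _ _ _) (natDegree_hypPoly_le _ _ _),
    coeff_hypPoly, coeff_hypPoly]
  simp only [Nat.choose_self, Nat.cast_one, one_mul]
  have hmk : (m : ℝ) ≤ k + 1 := by exact_mod_cast hkm
  have hQ : 0 < (-1 : ℝ) ^ m * fallingRatio (k + m) (k + a) m :=
    fallingRatio_sign_neg (by omega) (by linarith)
  have hP : 0 < (-1 : ℝ) ^ m * ((a + k - m) * fallingRatio (k + m) (m - a) k) := by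
    rcases Nat.lt_or_ge k m with h | h
    -- Here all `k` factors are negative, and `a + k - m = a - 1 < 0` supplies the missing sign.
    · obtain rfl : m = k + 1 := by omega
      have := fallingRatio_sign_neg (N := k + (k + 1)) (x := ((k + 1 : ℕ) : ℝ) - a) (n := k)
        (by omega) (by push_cast; linarith)
      have h2 := mul_pos (show 0 < 1 - a by linarith) this
      rw [pow_succ]; push_cast at h2 ⊢
      linarith
    · have h1 := fallingRatio_sign_of_le ha ha1 h (Nat.le_add_right k m)
      have h3 : (m : ℝ) ≤ k := by exact_mod_cast h
      have h2 := mul_pos (show 0 < a + k - m by linarith) h1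
      linarith
  have := mul_pos hP hQ
  have h1 : ((-1 : ℝ) ^ m) * (-1) ^ m = 1 := by rw [← mul_pow]; simp
  calc (0 : ℝ) < _ := this
    _ = (((-1 : ℝ) ^ m) * (-1) ^ m) * ((a + k - m) *
      (fallingRatio (k + m) (m - a) k * fallingRatio (k + m) (k + a) m)) := by ring
    _ = _ := by rw [h1, one_mul]

/-! ### Zeros of the denominator: Rodrigues formula and Rolle's theorem -/

/-- One step of the Rodrigues formula raises the degree of a hypergeometric polynomial. -/
lemma hypPoly_succ {N j : ℕ} (x : ℝ) (hj : j < N) :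
    C ((N : ℝ) - j) * hypPoly N x (j + 1) =
      (C ((N : ℝ) - x - j) - C x * (X - 1)) * hypPoly N x j +
        X * (X - 1) * derivative (hypPoly N x j) := by
  have e : (C ((N : ℝ) - x - j) - C x * (X - 1)) * hypPoly N x j +
        X * (X - 1) * derivative (hypPoly N x j) =
      C ((N : ℝ) - j) * hypPoly N x j - C x * (X * hypPoly N x j) +
        X * (X * derivative (hypPoly N x j)) - X * derivative (hypPoly N x j) := by
    simp only [map_sub]; ring
  rw [e]
  ext n
  rcases n with _ | n
  · simp [coeff_hypPoly]
  · simp only [coeff_add, coeff_sub, coeff_C_mul, coeff_X_mul, coeff_X_mul_derivative,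
      coeff_derivative, coeff_hypPoly]
    have h1 : (j.choose n : ℝ) * (((N : ℝ) - n) * fallingRatio N x (n + 1)) =
        (j.choose n : ℝ) * (((n : ℝ) - x) * fallingRatio N x n) := by
      rcases lt_or_ge n N with h | h
      · rw [fallingRatio_succ N x h]
      · rw [Nat.choose_eq_zero_of_lt (by omega)]; simp
    have h2 := cast_succ_mul_choose_succ j n
    have h3 : ((j + 1).choose (n + 1) : ℝ) = j.choose n + j.choose (n + 1) := by
      exact_mod_cast Nat.choose_succ_succ j n
    rw [h3]
    linear_combination h1 + fallingRatio N x (n + 1) * h2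

lemma eval_reflect_eq {G : ℝ[X]} {j : ℕ} (hG : G.natDegree ≤ j) {t : ℝ} (ht : t ≠ 0) :
    (reflect j G).eval t = t ^ j * G.eval t⁻¹ := by
  let _ : Invertible t⁻¹ := invertibleOfNonzero (inv_ne_zero ht)
  have h := eval₂_reflect_mul_pow (RingHom.id ℝ) t⁻¹ j G hG
  rw [invOf_eq_inv, inv_inv] at h
  rw [eval, eval, ← h, inv_pow]
  field_simp

/-- The weighted polynomial to which Rolle's theorem is applied. -/
noncomputable def rodriguesFun (N : ℕ) (x : ℝ) (j : ℕ) (t : ℝ) : ℝ :=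
  t ^ (x - j) * (1 - t) ^ ((N : ℝ) - x - j) * (reflect j (hypPoly N x j)).eval t

/-- On (0,1) the function is t^x (1-t)^(N-x-j) G_j(1/t), and its derivative is -(N-j) times the same
expression with j+1. Critical points are thus reciprocals of zeros of the next polynomial. -/
lemma hasDerivAt_rodriguesFun {N j : ℕ} (x : ℝ) (hj : j < N) {t : ℝ} (ht : t ∈ Set.Ioo (0 : ℝ) 1) :
    HasDerivAt (rodriguesFun N x j)
      (-(((N : ℝ) - j) * t ^ x * (1 - t) ^ ((N : ℝ) - x - j - 1) *
        (hypPoly N x (j + 1)).eval t⁻¹)) t := by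
  obtain ⟨h0, h1⟩ := ht
  have h1' : 0 < 1 - t := by linarith
  have hder : HasDerivAt (fun s : ℝ => s ^ x * (1 - s) ^ ((N : ℝ) - x - j) *
      (hypPoly N x j).eval s⁻¹) _ t :=
    (((hasDerivAt_id t).rpow_const (p := x) (Or.inl h0.ne')).mul
      (((hasDerivAt_id t).const_sub 1).rpow_const (p := (N : ℝ) - x - j) (Or.inl h1'.ne'))).mul
      (((hypPoly N x j).hasDerivAt t⁻¹).comp t (hasDerivAt_inv h0.ne'))
  refine (hder.congr_of_eventuallyEq ?_).congr_deriv ?_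
  · filter_upwards [lt_mem_nhds h0] with s hs
    rw [rodriguesFun, eval_reflect_eq (natDegree_hypPoly_le _ _ _) hs.ne', Real.rpow_sub hs,
      Real.rpow_natCast]
    field_simp
  · have h := congrArg (eval t⁻¹) (hypPoly_succ x hj)
    simp only [eval_mul, eval_add, eval_sub, eval_C, eval_X, eval_one] at h
    have e1 : t ^ x = t ^ (x - 1) * t := by
      rw [← Real.rpow_add_one h0.ne']; ring_nf
    have e2 : (1 - t) ^ ((N : ℝ) - x - j) = (1 - t) ^ ((N : ℝ) - x - j - 1) * (1 - t) := by
      rw [← Real.rpow_add_one h1'.ne']; ring_nf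
    simp only [id, Pi.mul_apply]
    have h' : -(((N : ℝ) - j) * t ^ x * (1 - t) ^ ((N : ℝ) - x - j - 1) *
        (hypPoly N x (j + 1)).eval t⁻¹) = -(t ^ x * (1 - t) ^ ((N : ℝ) - x - j - 1)) *
        (((N : ℝ) - j) * (hypPoly N x (j + 1)).eval t⁻¹) := by ring
    rw [h', h, e2, e1]
    field_simp
    ring

/-- Both exponents are positive, and `reflect` turns t^j G_j(1/t) into a polynomial, so nothing is
singular at the endpoints. -/
lemma continuous_rodriguesFun {N j : ℕ} {x : ℝ} (h1 : (j : ℝ) < x) (h2 : x + j < N) :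
    Continuous (rodriguesFun N x j) := by
  unfold rodriguesFun
  refine ((Real.continuous_rpow_const (by linarith)).mul
    ((Real.continuous_rpow_const (by linarith)).comp (continuous_const.sub continuous_id))).mul
    (Polynomial.continuous _)

/-- The hypergeometric polynomial of degree `j` has `j` distinct zeros in `(1, ∞)`. -/
lemma exists_inv_roots_hypPoly {N : ℕ} {x : ℝ} (j : ℕ)
    (h : ∀ i < j, (i : ℝ) < x ∧ x + i < N) :
    ∃ T : Finset ℝ, T.card = j ∧ ∀ t ∈ T, t ∈ Set.Ioo (0 : ℝ) 1 ∧
      (hypPoly N x j).eval t⁻¹ = 0 := by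
  induction j with
  | zero => exact ⟨∅, by simp⟩
  | succ j ih =>
    obtain ⟨T, hT, hroot⟩ := ih fun i hi => h i (by omega)
    obtain ⟨hx1, hx2⟩ := h j (by omega)
    have hjN : j < N := by
      have : (j : ℝ) < N := by have := Nat.cast_nonneg (α := ℝ) j; linarith
      exact_mod_cast this
    have hG0 : hypPoly N x (j + 1) ≠ 0 := fun h0 => by
      have := eval_zero_hypPoly N x (j + 1)
      rw [h0] at this; simp at this
    -- The `j` known zeros and the two endpoints make `j + 2` zeros of `rodriguesFun`; Rolle gives
    -- `j + 1` critical points between them.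
    set S : Finset ℝ := insert 0 (insert 1 T) with hS
    have h1T : (1 : ℝ) ∉ T := fun hm => (hroot 1 hm).1.2.ne rfl
    have h0T : (0 : ℝ) ∉ insert 1 T := by
      rw [Finset.mem_insert]; rintro (hm | hm)
      · norm_num at hm
      · exact (hroot 0 hm).1.1.ne rfl
    have hScard : S.card = j + 2 := by
      rw [hS, Finset.card_insert_of_notMem h0T, Finset.card_insert_of_notMem h1T, hT]
    have hSI : ∀ t ∈ S, t ∈ Set.Icc (0 : ℝ) 1 ∧ rodriguesFun N x j t = 0 := by
      intro t ht
      rw [hS, Finset.mem_insert, Finset.mem_insert] at ht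
      rcases ht with rfl | rfl | ht
      · refine ⟨by simp, ?_⟩
        rw [rodriguesFun, Real.zero_rpow (by linarith)]; simp
      · refine ⟨by simp, ?_⟩
        rw [rodriguesFun, sub_self, Real.zero_rpow (by linarith)]; simp
      · obtain ⟨hI, he⟩ := hroot t ht
        refine ⟨Set.Ioo_subset_Icc_self hI, ?_⟩
        rw [rodriguesFun, eval_reflect_eq (natDegree_hypPoly_le _ _ _) hI.1.ne', he]; simp
    set U : Finset ℝ := ((hypPoly N x (j + 1)).roots.toFinset.image (fun z => z⁻¹)).filter
      (fun t => t ∈ Set.Ioo (0 : ℝ) 1) with hU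
    have hle : S.card ≤ U.card + 1 := by
      refine Finset.card_le_of_interleaved fun u hu v hv huv _ => ?_
      obtain ⟨hu1, hu0⟩ := hSI u hu
      obtain ⟨hv1, hv0⟩ := hSI v hv
      have hsub : ∀ t ∈ Set.Ioo u v, t ∈ Set.Ioo (0 : ℝ) 1 := fun t ht =>
        ⟨hu1.1.trans_lt ht.1, ht.2.trans_le hv1.2⟩
      obtain ⟨t, ht, he⟩ := exists_hasDerivAt_eq_zero huv
        (continuous_rodriguesFun hx1 hx2).continuousOn (hu0.trans hv0.symm)
        (fun t ht => hasDerivAt_rodriguesFun x hjN (hsub t ht))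
      have htI := hsub t ht
      refine ⟨t, ?_, ht⟩
      rw [hU, Finset.mem_filter, Finset.mem_image]
      refine ⟨⟨t⁻¹, ?_, inv_inv t⟩, htI⟩
      rw [Multiset.mem_toFinset, mem_roots hG0, IsRoot]
      have p1 : (N : ℝ) - j ≠ 0 := sub_ne_zero.2 (by exact_mod_cast hjN.ne')
      have p2 := (Real.rpow_pos_of_pos htI.1 x).ne'
      have p3 := (Real.rpow_pos_of_pos (sub_pos.2 htI.2) ((N : ℝ) - x - j - 1)).ne'
      simpa [p1, p2, p3] using he
    obtain ⟨V, hVU, hV⟩ := Finset.exists_subset_card_eq (show j + 1 ≤ U.card by omega)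
    refine ⟨V, hV, fun t ht => ?_⟩
    have := hVU ht
    rw [hU, Finset.mem_filter, Finset.mem_image] at this
    obtain ⟨⟨z, hz, rfl⟩, hI⟩ := this
    refine ⟨hI, ?_⟩
    rw [inv_inv]
    exact (mem_roots hG0).1 (Multiset.mem_toFinset.1 hz)

lemma natDegree_prod_one_sub_le (T : Finset ℝ) :
    (∏ t ∈ T, (1 - C t * X)).natDegree ≤ T.card := by
  refine (natDegree_prod_le _ _).trans ?_
  rw [Finset.card_eq_sum_ones]
  refine Finset.sum_le_sum fun t _ => ?_
  compute_degree

/-- Both sides have degree at most `T.card` and agree at the `T.card` points 1/t and at 0. -/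
lemma eq_prod_of_inv_roots {Q : ℝ[X]} (T : Finset ℝ) (hdeg : Q.natDegree ≤ T.card)
    (h0 : Q.eval 0 = 1) (hT : ∀ t ∈ T, t ≠ 0 ∧ Q.eval t⁻¹ = 0) :
    Q = ∏ t ∈ T, (1 - C t * X) := by
  have hinj : Set.InjOn (fun t : ℝ => t⁻¹) T := fun _ _ _ _ h => inv_injective h
  have h0T : (0 : ℝ) ∉ T.image (fun t => t⁻¹) := by
    rw [Finset.mem_image]; rintro ⟨t, ht, he⟩
    exact (hT t ht).1 (inv_eq_zero.1 he)
  have hc : (insert 0 (T.image (fun t => t⁻¹))).card = T.card + 1 := by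
    rw [Finset.card_insert_of_notMem h0T, Finset.card_image_of_injOn hinj]
  refine eq_of_degrees_lt_of_eval_finset_eq (insert 0 (T.image (fun t => t⁻¹))) ?_ ?_ ?_
  · rw [hc]
    exact (natDegree_le_iff_degree_le.1 hdeg).trans_lt (by exact_mod_cast Nat.lt_succ_self _)
  · rw [hc]
    exact (natDegree_le_iff_degree_le.1 (natDegree_prod_one_sub_le T)).trans_lt
      (by exact_mod_cast Nat.lt_succ_self _)
  · intro z hz
    rw [Finset.mem_insert, Finset.mem_image] at hz
    rcases hz with rfl | ⟨t, ht, rfl⟩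
    · simp [h0, eval_prod]
    · rw [(hT t ht).2, eval_prod, Finset.prod_eq_zero ht]
      simp [(hT t ht).1]

/-- The Padé denominator factors over the reals, with all zeros in `(1, ∞)`. -/
lemma exists_factorization_den {a : ℝ} (ha : 0 < a) (ha1 : a < 1) {k m : ℕ} (hkm : m ≤ k + 1) :
    ∃ T : Finset ℝ, T.card = m ∧ (∀ t ∈ T, t ∈ Set.Ioo (0 : ℝ) 1) ∧
      hypPoly (k + m) (k + a) m = ∏ t ∈ T, (1 - C t * X) := by
  obtain ⟨T, hc, hT⟩ := exists_inv_roots_hypPoly (N := k + m) (x := k + a) m (fun i hi => by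
    have h1 : (i : ℝ) + 1 ≤ m := by exact_mod_cast hi
    have h2 : (m : ℝ) ≤ k + 1 := by exact_mod_cast hkm
    push_cast
    constructor <;> linarith)
  exact ⟨T, hc, fun t ht => (hT t ht).1, eq_prod_of_inv_roots T
    (by rw [hc]; exact natDegree_hypPoly_le _ _ _) (eval_zero_hypPoly _ _ _)
    fun t ht => ⟨(hT t ht).1.1.ne', (hT t ht).2⟩⟩

/-! ### Partial fractions of P/Q with nonnegative weights -/

/-- The Taylor coefficients of `P / Q` of low order are nonnegative when the Wronskian is a
multiple of a high power of `X`. -/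
lemma exists_trunc_quotient {a c : ℝ} (ha : 0 < a) {P Q : ℝ[X]} {N M : ℕ} (hMN : M ≤ N + 1)
    (hP : P.eval 0 = 1) (hQ : Q.eval 0 = 1) (hW : padeWronskian a P Q = C c * X ^ N) :
    ∃ T : ℝ[X], T.degree < M ∧ (∀ n, 0 ≤ T.coeff n) ∧ X ^ M ∣ P - Q * T := by
  have hQ0 : PowerSeries.constantCoeff (Q : PowerSeries ℝ) ≠ 0 := by
    rw [Polynomial.constantCoeff_coe, coeff_zero_eq_eval_zero, hQ]; norm_num
  set q : PowerSeries ℝ := (Q : PowerSeries ℝ)⁻¹ with hq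
  have hqQ : q * (Q : PowerSeries ℝ) = 1 := PowerSeries.inv_mul_cancel _ hQ0
  set r : PowerSeries ℝ := (P : PowerSeries ℝ) * q with hr
  have hrQ : (P : PowerSeries ℝ) = r * Q := by rw [hr, mul_assoc, hqQ, mul_one]
  have hdP : ((derivative P : ℝ[X]) : PowerSeries ℝ) =
      PowerSeries.derivative ℝ r * Q + r * ((derivative Q : ℝ[X]) : PowerSeries ℝ) := by
    rw [← PowerSeries.derivative_coe, ← PowerSeries.derivative_coe, hrQ, Derivation.leibniz]
    simp only [smul_eq_mul]; ring
  have hode : PowerSeries.C a * r - (1 - PowerSeries.X) * PowerSeries.derivative ℝ r =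
      PowerSeries.X ^ N * (PowerSeries.C c * q ^ 2) := by
    have h := congrArg (fun f : ℝ[X] => (f : PowerSeries ℝ)) hW
    simp only [padeWronskian, coe_sub, coe_mul, coe_C, coe_one, coe_X, coe_pow, hdP, hrQ] at h
    linear_combination q ^ 2 * h -
      (PowerSeries.C a * r - (1 - PowerSeries.X) * PowerSeries.derivative ℝ r) *
        (q * (Q : PowerSeries ℝ) + 1) * hqQ
  -- Below degree `N` the right side of `hode` vanishes, leaving the Taylor recursion of (1-z)^(-a).
  have hrec : ∀ n < N, (a + n) * PowerSeries.coeff n r = (n + 1) * PowerSeries.coeff (n + 1) r := by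
    intro n hn
    have h := congrArg (PowerSeries.coeff n) hode
    rw [PowerSeries.coeff_X_pow_mul', if_neg (by omega), sub_mul, one_mul, map_sub, map_sub,
      PowerSeries.coeff_C_mul, PowerSeries.coeff_derivative] at h
    rcases n with _ | n
    · simp at h ⊢
      linear_combination h
    · rw [PowerSeries.coeff_succ_X_mul, PowerSeries.coeff_derivative] at h
      push_cast at h ⊢
      linear_combination h
  have hr0 : PowerSeries.coeff 0 r = 1 := by
    have h := congrArg (PowerSeries.coeff 0) hrQ
    simp only [PowerSeries.coeff_zero_eq_constantCoeff,
      map_mul, Polynomial.constantCoeff_coe, coeff_zero_eq_eval_zero, hP, hQ, mul_one] at h ⊢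
    exact h.symm
  have hpos : ∀ n ≤ N, 0 ≤ PowerSeries.coeff n r := by
    intro n
    induction n with
    | zero => intro _; rw [hr0]; norm_num
    | succ n ih =>
      intro hn
      have h1 := hrec n hn
      have h2 : 0 ≤ (a + n) * PowerSeries.coeff n r := mul_nonneg (by positivity) (ih (by omega))
      rw [h1] at h2
      exact nonneg_of_mul_nonneg_right h2 (by positivity)
  refine ⟨PowerSeries.trunc M r, PowerSeries.degree_trunc_lt r M, fun n => ?_, ?_⟩
  · rw [PowerSeries.coeff_trunc]
    split_ifs with h
    · exact hpos n (by omega)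
    · exact le_rfl
  · rw [X_pow_dvd_iff]
    intro d hd
    rw [coeff_sub, sub_eq_zero, ← Polynomial.coeff_coe, ← Polynomial.coeff_coe, hrQ, coe_mul,
      mul_comm]
    have h1 : PowerSeries.trunc M ((Q : PowerSeries ℝ) * r) =
        PowerSeries.trunc M ((Q : PowerSeries ℝ) * ((PowerSeries.trunc M r : ℝ[X]) : PowerSeries ℝ)) := by
      rw [PowerSeries.trunc_mul_trunc]
    have h2 := congrArg (fun f => f.coeff d) h1
    simpa only [PowerSeries.coeff_trunc, hd, if_true] using h2

lemma eval_derivative_prod_one_sub (T : Finset ℝ) {t : ℝ} (ht : t ∈ T) (ht0 : t ≠ 0) :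
    (derivative (∏ s ∈ T, (1 - C s * X))).eval t⁻¹ =
      -t * (∏ s ∈ T.erase t, (1 - C s * X)).eval t⁻¹ := by
  rw [← Finset.mul_prod_erase T _ ht, derivative_mul]
  simp [ht0]

lemma eval_prod_erase_ne_zero (T : Finset ℝ) {t : ℝ} (ht0 : t ≠ 0) :
    (∏ s ∈ T.erase t, (1 - C s * X)).eval t⁻¹ ≠ 0 := by
  rw [eval_prod, Finset.prod_ne_zero_iff]
  intro s hs
  simp only [eval_sub, eval_one, eval_mul, eval_C, eval_X]
  intro h
  have : s = t := by field_simp at h; linarith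
  exact (Finset.mem_erase.1 hs).1 this

/-- Partial fraction decomposition over distinct simple poles, with denominators cleared. -/
lemma eq_sum_partial_fractions (T : Finset ℝ) (hT : ∀ t ∈ T, t ≠ 0) {R : ℝ[X]}
    (hR : R.degree < T.card) :
    R = ∑ t ∈ T, C (R.eval t⁻¹ / (∏ s ∈ T.erase t, (1 - C s * X)).eval t⁻¹) *
      ∏ s ∈ T.erase t, (1 - C s * X) := by
  have hinj : Set.InjOn (fun t : ℝ => t⁻¹) T := fun _ _ _ _ h => inv_injective h
  have hc : (T.image (fun t => t⁻¹)).card = T.card := Finset.card_image_of_injOn hinj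
  refine eq_of_degrees_lt_of_eval_finset_eq (T.image (fun t => t⁻¹)) (by rwa [hc]) ?_ ?_
  · rw [hc, ← mem_degreeLT]
    refine Submodule.sum_mem _ fun t ht => ?_
    rw [mem_degreeLT]
    refine (natDegree_le_iff_degree_le.1 ((natDegree_C_mul_le _ _).trans
      (natDegree_prod_one_sub_le (T.erase t)))).trans_lt ?_
    rw [Finset.card_erase_of_mem ht]
    have := Finset.card_pos.2 ⟨t, ht⟩
    exact_mod_cast Nat.sub_lt this one_pos
  · intro z hz
    obtain ⟨t, ht, rfl⟩ := Finset.mem_image.1 hz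
    rw [eval_finsetSum, Finset.sum_eq_single t]
    · rw [eval_mul, eval_C, div_mul_cancel₀ _ (eval_prod_erase_ne_zero T (hT t ht))]
    · intro s _ hst
      have h0 : (∏ u ∈ T.erase s, (1 - C u * X)).eval t⁻¹ = 0 := by
        rw [eval_prod, Finset.prod_eq_zero (Finset.mem_erase.2 ⟨hst.symm, ht⟩)]
        simp [hT t ht]
      rw [eval_mul, h0, mul_zero]
    · exact fun h => absurd ht h

/-- If the Wronskian is a positive multiple of `X ^ N` and all zeros of `Q` lie in `(1, ∞)`, then
`P / Q` is a polynomial with nonnegative coefficients plus `X ^ M` times a sum of simple fractions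
with positive weights. -/
lemma exists_stieltjes_decomposition {a c : ℝ} (ha : 0 < a) (hc : 0 < c) {P : ℝ[X]} {k m : ℕ}
    (hkm : m ≤ k + 1) (T : Finset ℝ) (hTc : T.card = m) (hT : ∀ t ∈ T, t ∈ Set.Ioo (0 : ℝ) 1)
    (hP : P.eval 0 = 1) (hPd : P.natDegree ≤ k)
    (hW : padeWronskian a P (∏ t ∈ T, (1 - C t * X)) = C c * X ^ (k + m)) :
    ∃ (S : ℝ[X]) (M : ℕ) (w : ℝ → ℝ), (∀ n, 0 ≤ S.coeff n) ∧ (∀ t ∈ T, 0 ≤ w t) ∧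
      P = (∏ t ∈ T, (1 - C t * X)) * S +
        X ^ M * ∑ t ∈ T, C (w t) * ∏ s ∈ T.erase t, (1 - C s * X) := by
  set Q : ℝ[X] := ∏ t ∈ T, (1 - C t * X) with hQdef
  have hQ0 : Q.eval 0 = 1 := by simp [hQdef, eval_prod]
  have hQd : Q.natDegree ≤ m := hTc ▸ natDegree_prod_one_sub_le T
  -- For `M = k + 1 - m` the product Q S still has degree at most `k`, so R has degree below `m`, as
  -- partial fractions require. If `m = k + 1`, then `M = 0` and S = 0.
  obtain ⟨S, hSd, hS, R, hR⟩ := exists_trunc_quotient (M := k + 1 - m) ha (by omega) hP hQ0 hW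
  have hRd : R.degree < T.card := by
    have h1 : (P - Q * S).degree < ((k + 1 : ℕ) : WithBot ℕ) := by
      rw [← mem_degreeLT]
      refine Submodule.sub_mem _ ?_ ?_
      · rw [mem_degreeLT]
        exact (natDegree_le_iff_degree_le.1 hPd).trans_lt (by exact_mod_cast Nat.lt_succ_self k)
      · rw [mem_degreeLT]
        by_cases hS0 : S = 0
        · simp [hS0]
        · have hS1 := (natDegree_lt_iff_degree_lt hS0).2 hSd
          refine (natDegree_le_iff_degree_le.1
            (natDegree_mul_le_of_le hQd le_rfl)).trans_lt ?_
          exact_mod_cast (by omega : m + S.natDegree < k + 1)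
    rw [hR] at h1
    by_cases hR0 : R = 0
    · simp [hR0]
    · rw [← natDegree_lt_iff_degree_lt (mul_ne_zero (pow_ne_zero _ X_ne_zero) hR0),
        natDegree_mul (pow_ne_zero _ X_ne_zero) hR0, natDegree_X_pow] at h1
      rw [← natDegree_lt_iff_degree_lt hR0, hTc]
      omega
  refine ⟨S, k + 1 - m, fun t => R.eval t⁻¹ / (∏ s ∈ T.erase t, (1 - C s * X)).eval t⁻¹, hS,
    fun t ht => ?_, ?_⟩
  · obtain ⟨ht0, ht1⟩ := hT t ht
    have hQt : Q.eval t⁻¹ = 0 := by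
      rw [hQdef, eval_prod, Finset.prod_eq_zero ht]; simp [ht0.ne']
    have hQ' := eval_derivative_prod_one_sub T ht ht0.ne'
    rw [← hQdef] at hQ'
    have hne := eval_prod_erase_ne_zero T ht0.ne'
    set D := (∏ s ∈ T.erase t, (1 - C s * X)).eval t⁻¹
    have hWt := congrArg (eval t⁻¹) hW
    have hRt := congrArg (eval t⁻¹) hR
    simp only [padeWronskian, eval_sub, eval_mul, eval_C, eval_one, eval_X, eval_pow, hQt, hQ']
      at hWt hRt
    have hζ : 1 < t⁻¹ := (one_lt_inv₀ ht0).2 ht1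
    -- At a zero of Q the Wronskian reduces to (1-X) P Q'; equating it with c X^(k+m) fixes the sign
    -- of the weight.
    have hkey : (D ^ 2 * t⁻¹ ^ (k + 1 - m) * (t⁻¹ - 1) * t) * (R.eval t⁻¹ / D) =
        c * t⁻¹ ^ (k + m) := by
      rw [← hWt]
      have : P.eval t⁻¹ = t⁻¹ ^ (k + 1 - m) * R.eval t⁻¹ := by linarith
      rw [this]
      field_simp
      ring
    have hpos : 0 < D ^ 2 * t⁻¹ ^ (k + 1 - m) * (t⁻¹ - 1) * t := by
      have := sub_pos.2 hζ
      positivity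
    refine nonneg_of_mul_nonneg_right (b := R.eval t⁻¹ / D) ?_ hpos
    rw [hkey]; positivity
  · rw [← eq_sum_partial_fractions T (fun t ht => (hT t ht).1.ne') hRd, ← hR]
    ring

/-! ### Majorization on the unit disc -/

/-- On the unit disc, `u` is bounded at `z` by its value at any real point `y ≥ ‖z‖`, and these
values are nonnegative. Functions with nonnegative Taylor coefficients have this property. -/
def NormMajorized (u : ℂ → ℂ) : Prop :=
  ∀ (z : ℂ) (y : ℝ), ‖z‖ ≤ y → y < 1 → u y = (‖u y‖ : ℂ) ∧ ‖u z‖ ≤ ‖u y‖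

namespace NormMajorized

lemma const {c : ℝ} (hc : 0 ≤ c) : NormMajorized fun _ => (c : ℂ) := fun _ _ _ _ => by
  simp [abs_of_nonneg hc]

lemma id : NormMajorized fun z => z := fun z y h _ => by
  have : 0 ≤ y := (norm_nonneg z).trans h
  simp [abs_of_nonneg this, h]

lemma mul {u v : ℂ → ℂ} (hu : NormMajorized u) (hv : NormMajorized v) :
    NormMajorized fun z => u z * v z := fun z y h h1 => by
  obtain ⟨hu1, hu2⟩ := hu z y h h1
  obtain ⟨hv1, hv2⟩ := hv z y h h1
  constructor
  · rw [norm_mul, Complex.ofReal_mul, ← hu1, ← hv1]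
  · rw [norm_mul, norm_mul]; gcongr

lemma add {u v : ℂ → ℂ} (hu : NormMajorized u) (hv : NormMajorized v) :
    NormMajorized fun z => u z + v z := fun z y h h1 => by
  obtain ⟨hu1, hu2⟩ := hu z y h h1
  obtain ⟨hv1, hv2⟩ := hv z y h h1
  have e : u y + v y = ((‖u y‖ + ‖v y‖ : ℝ) : ℂ) := by
    rw [Complex.ofReal_add, ← hu1, ← hv1]
  have e2 : ‖u y + v y‖ = ‖u y‖ + ‖v y‖ := by
    rw [e, Complex.norm_real, Real.norm_of_nonneg (by positivity)]
  refine ⟨by simp only [e2]; exact e, ?_⟩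
  simp only [e2]
  exact (norm_add_le _ _).trans (add_le_add hu2 hv2)

lemma pow {u : ℂ → ℂ} (hu : NormMajorized u) (n : ℕ) : NormMajorized fun z => u z ^ n := by
  induction n with
  | zero => simpa using const zero_le_one
  | succ n ih => simpa only [pow_succ] using ih.mul hu

lemma sum {ι : Type*} (s : Finset ι) {u : ι → ℂ → ℂ} (hu : ∀ i ∈ s, NormMajorized (u i)) :
    NormMajorized fun z => ∑ i ∈ s, u i z := by
  classical
  induction s using Finset.induction_on with
  | empty => simpa using const le_rfl
  | insert i s hi ih =>
    simp only [Finset.sum_insert hi]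
    exact (hu i (by simp)).add (ih fun j hj => hu j (by simp [hj]))

lemma prod {ι : Type*} (s : Finset ι) {u : ι → ℂ → ℂ} (hu : ∀ i ∈ s, NormMajorized (u i)) :
    NormMajorized fun z => ∏ i ∈ s, u i z := by
  classical
  induction s using Finset.induction_on with
  | empty => simpa using const zero_le_one
  | insert i s hi ih =>
    simp only [Finset.prod_insert hi]
    exact (hu i (by simp)).mul (ih fun j hj => hu j (by simp [hj]))

lemma inv_one_sub {t : ℝ} (ht : t ∈ Set.Ioo (0 : ℝ) 1) :
    NormMajorized fun z => (1 - (t : ℂ) * z)⁻¹ := fun z y h h1 => by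
  have hy : 0 ≤ y := (norm_nonneg z).trans h
  have hpos : 0 < 1 - t * y := by nlinarith [ht.1, ht.2]
  have e : (1 - (t : ℂ) * y)⁻¹ = (((1 - t * y)⁻¹ : ℝ) : ℂ) := by push_cast; rfl
  have e2 : ‖(1 - (t : ℂ) * y)⁻¹‖ = (1 - t * y)⁻¹ := by
    rw [e, Complex.norm_real, Real.norm_of_nonneg (inv_pos.2 hpos).le]
  refine ⟨by simp only [e2]; exact e, ?_⟩
  simp only [e2]
  rw [norm_inv]
  refine inv_anti₀ hpos ?_
  have h3 : ‖(t : ℂ) * z‖ ≤ t * y := by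
    rw [norm_mul, Complex.norm_real, Real.norm_of_nonneg ht.1.le]
    exact mul_le_mul_of_nonneg_left h ht.1.le
  have h4 := norm_sub_norm_le (1 : ℂ) ((t : ℂ) * z)
  rw [norm_one] at h4
  linarith

lemma aeval {S : ℝ[X]} (hS : ∀ n, 0 ≤ S.coeff n) : NormMajorized fun z => aeval z S := by
  simp only [aeval_eq_sum_range, Complex.real_smul]
  exact sum _ fun n _ => (const (hS n)).mul (id.pow n)

lemma congr {u v : ℂ → ℂ} (hu : NormMajorized u) (h : ∀ z, ‖z‖ < 1 → v z = u z) :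
    NormMajorized v := fun z y hz hy => by
  have hy' : ‖(y : ℂ)‖ < 1 := by
    rw [Complex.norm_real, Real.norm_of_nonneg ((norm_nonneg z).trans hz)]; exact hy
  rw [h z (hz.trans_lt hy), h y hy']
  exact hu z y hz hy

end NormMajorized

/-- Comparison along rays: a function vanishing at `0` whose derivative is `z ^ N` times a
majorized function is bounded by `‖z‖ ^ (N + 1)` as soon as it is at most `1` on `(0, 1)`. -/
lemma norm_le_pow_of_majorized_deriv {g h : ℂ → ℂ} {N : ℕ}
    (hg : ∀ z, ‖z‖ < 1 → HasDerivAt g (z ^ N * h z) z) (h0 : g 0 = 0) (hh : NormMajorized h)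
    (h1 : ∀ y : ℝ, 0 < y → y < 1 → (g y).re ≤ 1) {z : ℂ} (hz : ‖z‖ < 1) :
    ‖g z‖ ≤ ‖z‖ ^ (N + 1) := by
  have key : ∀ y : ℝ, ‖z‖ < y → y < 1 → ‖g z‖ ≤ (‖z‖ / y) ^ (N + 1) := by
    intro y hzy hy1
    have hy0 : 0 < y := (norm_nonneg z).trans_lt hzy
    have hball : ∀ w : ℂ, ‖w‖ < 1 → ∀ s ∈ Set.Icc (0 : ℝ) 1, ‖(s : ℂ) * w‖ < 1 := by
      intro w hw s hs
      rw [norm_mul, Complex.norm_real, Real.norm_of_nonneg hs.1]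
      exact (mul_le_of_le_one_left (norm_nonneg w) hs.2).trans_lt hw
    have hyn : ‖(y : ℂ)‖ < 1 := by rwa [Complex.norm_real, Real.norm_of_nonneg hy0.le]
    have hd : ∀ w : ℂ, ‖w‖ < 1 → ∀ s ∈ Set.Icc (0 : ℝ) 1,
        HasDerivAt (fun s : ℂ => g (s * w)) (((s : ℂ) * w) ^ N * h ((s : ℂ) * w) * w) (s : ℂ) :=
      fun w hw s hs => (hg _ (hball w hw s hs)).comp (s : ℂ) (hasDerivAt_mul_const w)
    have hf := fun s hs => (hd z hz s hs).comp_ofReal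
    have hB := fun s hs => ((hd y hyn s hs).real_of_complex).const_mul ((‖z‖ / y) ^ (N + 1))
    -- Compare along the segments from 0 to `z` and from 0 to `y`: the speed on the first is at most
    -- (‖z‖/y)^(N+1) times the speed on the second.
    have hle := image_norm_le_of_norm_deriv_right_le_deriv_boundary'
      (f := fun s : ℝ => g ((s : ℂ) * z)) (a := 0) (b := 1)
      (B := fun s : ℝ => (‖z‖ / y) ^ (N + 1) * (g ((s : ℂ) * y)).re)
      (fun s hs => (hf s hs).continuousAt.continuousWithinAt)
      (fun s hs => (hf s (Set.Ico_subset_Icc_self hs)).hasDerivWithinAt)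
      (by simp [h0])
      (fun s hs => (hB s hs).continuousAt.continuousWithinAt)
      (fun s hs => (hB s (Set.Ico_subset_Icc_self hs)).hasDerivWithinAt)
      (fun s hs => by
        have hs0 := hs.1
        have hsy : ‖(s : ℂ) * z‖ ≤ s * y := by
          rw [norm_mul, Complex.norm_real, Real.norm_of_nonneg hs0]
          exact mul_le_mul_of_nonneg_left hzy.le hs0
        obtain ⟨e1, e2⟩ := hh _ (s * y) hsy (by nlinarith [hs.2])
        rw [Complex.ofReal_mul] at e1 e2
        have e3 : (((s : ℂ) * y) ^ N * h ((s : ℂ) * y) * y).re =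
            (s * y) ^ N * ‖h ((s : ℂ) * y)‖ * y := by
          have : ((s : ℂ) * y) ^ N * h ((s : ℂ) * y) * y =
              (((s * y) ^ N * ‖h ((s : ℂ) * y)‖ * y : ℝ) : ℂ) := by
            push_cast; rw [← e1]
          rw [this, Complex.ofReal_re]
        rw [e3, norm_mul, norm_mul, norm_pow, norm_mul, Complex.norm_real,
          Real.norm_of_nonneg hs0]
        calc (s * ‖z‖) ^ N * ‖h ((s : ℂ) * z)‖ * ‖z‖
            ≤ (s * ‖z‖) ^ N * ‖h ((s : ℂ) * y)‖ * ‖z‖ := by gcongr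
          _ = (‖z‖ / y) ^ (N + 1) * ((s * y) ^ N * ‖h ((s : ℂ) * y)‖ * y) := by
            rw [pow_succ, div_pow, mul_pow, mul_pow]; field_simp)
      (Set.right_mem_Icc.2 zero_le_one)
    simp only [Complex.ofReal_one, one_mul] at hle
    refine hle.trans (mul_le_of_le_one_right (by positivity) (h1 y hy0 hy1))
  -- Nothing is assumed about `g` at 1, so `y` tends to 1 only in the final bound.
  have hlim : Filter.Tendsto (fun y : ℝ => (‖z‖ / y) ^ (N + 1)) (𝓝[<] 1)
      (𝓝 ((‖z‖ / 1) ^ (N + 1))) := by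
    have hc : ContinuousAt (fun y : ℝ => (‖z‖ / y) ^ (N + 1)) 1 :=
      (continuousAt_const.div continuousAt_id one_ne_zero).pow _
    exact hc.tendsto.mono_left nhdsWithin_le_nhds
  rw [div_one] at hlim
  refine ge_of_tendsto hlim ?_
  filter_upwards [Ioo_mem_nhdsLT hz] with y hy using key y hy.1 hy.2

/-! ### The residual estimate -/

lemma hasDerivAt_aeval_div {P Q : ℝ[X]} {z : ℂ} (hQ : aeval z Q ≠ 0) :
    HasDerivAt (fun z : ℂ => aeval z P / aeval z Q)
      ((aeval z (derivative P) * aeval z Q - aeval z P * aeval z (derivative Q)) /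
        aeval z Q ^ 2) z :=
  (P.hasDerivAt_aeval z).div (Q.hasDerivAt_aeval z) hQ

lemma aeval_padeWronskian {a c : ℝ} {P Q : ℝ[X]} {N : ℕ}
    (hW : padeWronskian a P Q = C c * X ^ N) (z : ℂ) :
    (a : ℂ) * (aeval z P * aeval z Q) - (1 - z) *
      (aeval z (derivative P) * aeval z Q - aeval z P * aeval z (derivative Q)) = c * z ^ N := by
  have h := congrArg (aeval z) hW
  simpa [padeWronskian, aeval_C] using h

lemma aeval_prod_one_sub (T : Finset ℝ) (z : ℂ) :
    aeval z (∏ t ∈ T, (1 - C t * X) : ℝ[X]) = ∏ t ∈ T, (1 - (t : ℂ) * z) := by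
  simp [map_prod, aeval_C]

lemma one_sub_mul_ne_zero {t : ℝ} (ht : t ∈ Set.Ioo (0 : ℝ) 1) {z : ℂ} (hz : ‖z‖ < 1) :
    1 - (t : ℂ) * z ≠ 0 := by
  intro h
  have h2 : ‖(t : ℂ) * z‖ = 1 := by rw [← sub_eq_zero.1 h, norm_one]
  rw [norm_mul, Complex.norm_real, Real.norm_of_nonneg ht.1.le] at h2
  nlinarith [ht.1, ht.2, norm_nonneg z]

/-- The residual estimate for the real Padé pair. -/
lemma norm_residual_le {p k m : ℕ} (hp : 2 ≤ p) {c : ℝ} (hc : 0 < c) {P : ℝ[X]}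
    (hkm : m ≤ k + 1) (T : Finset ℝ) (hTc : T.card = m) (hT : ∀ t ∈ T, t ∈ Set.Ioo (0 : ℝ) 1)
    (hP : P.eval 0 = 1) (hPd : P.natDegree ≤ k)
    (hW : padeWronskian (1 / p) P (∏ t ∈ T, (1 - C t * X)) = C c * X ^ (k + m))
    {z : ℂ} (hz : ‖z‖ < 1) :
    aeval z (∏ t ∈ T, (1 - C t * X) : ℝ[X]) ≠ 0 ∧
      ‖1 - (1 - z) * (aeval z P / aeval z (∏ t ∈ T, (1 - C t * X) : ℝ[X])) ^ p‖ ≤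
        ‖z‖ ^ (k + m + 1) := by
  obtain ⟨S, M, w, hS, hw, hdec⟩ :=
    exists_stieltjes_decomposition (a := 1 / p) (by positivity) hc hkm T hTc hT hP hPd hW
  set Q : ℝ[X] := ∏ t ∈ T, (1 - C t * X) with hQdef
  have hQz : ∀ z : ℂ, aeval z Q = ∏ t ∈ T, (1 - (t : ℂ) * z) := aeval_prod_one_sub T
  have hQne : ∀ z : ℂ, ‖z‖ < 1 → aeval z Q ≠ 0 := fun z hz => by
    rw [hQz, Finset.prod_ne_zero_iff]
    exact fun t ht => one_sub_mul_ne_zero (hT t ht) hz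
  have hQinv : NormMajorized fun z => (aeval z Q)⁻¹ := by
    simp only [hQz, ← Finset.prod_inv_distrib]
    exact NormMajorized.prod T fun t ht => NormMajorized.inv_one_sub (hT t ht)
  set r : ℂ → ℂ := fun z => aeval z P / aeval z Q with hr
  have hrmaj : NormMajorized r := by
    have hmaj : NormMajorized fun z : ℂ => aeval z S +
        z ^ M * ∑ t ∈ T, (w t : ℂ) * (1 - (t : ℂ) * z)⁻¹ :=
      (NormMajorized.aeval hS).add ((NormMajorized.id.pow M).mul (NormMajorized.sum T
        fun t ht => (NormMajorized.const (hw t ht)).mul (NormMajorized.inv_one_sub (hT t ht))))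
    refine hmaj.congr fun z hz => ?_
    have h := congrArg (aeval z) hdec
    rw [map_add, map_mul, map_mul, map_pow, aeval_X, map_sum] at h
    have hterm : ∀ t ∈ T, aeval z (C (w t) * ∏ s ∈ T.erase t, (1 - C s * X) : ℝ[X]) =
        aeval z Q * ((w t : ℂ) * (1 - (t : ℂ) * z)⁻¹) := by
      intro t ht
      rw [map_mul, aeval_prod_one_sub, hQz, ← Finset.mul_prod_erase T _ ht, aeval_C]
      have := one_sub_mul_ne_zero (hT t ht) hz
      rw [Complex.coe_algebraMap, mul_left_comm, ← mul_assoc (w t : ℂ), mul_comm (1 - (t : ℂ) * z),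
        mul_assoc, mul_assoc, mul_inv_cancel₀ this, mul_one]
    rw [Finset.sum_congr rfl hterm, ← Finset.mul_sum] at h
    simp only [hr]
    rw [div_eq_iff (hQne z hz), h]
    ring
  refine ⟨hQne z hz, ?_⟩
  refine norm_le_pow_of_majorized_deriv (g := fun z => 1 - (1 - z) * r z ^ p)
    (h := fun z => ((p * c : ℝ) : ℂ) * (r z ^ (p - 1) * ((aeval z Q)⁻¹) ^ 2)) ?_ ?_ ?_ ?_ hz
  · intro z hz
    have hQ := hQne z hz
    have hd := (((hasDerivAt_id z).const_sub 1).mul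
      ((hasDerivAt_aeval_div (P := P) hQ).pow p)).const_sub 1
    refine hd.congr_deriv ?_
    have hWz := aeval_padeWronskian hW z
    obtain ⟨n, rfl⟩ : ∃ n, p = n + 1 := ⟨p - 1, by omega⟩
    have hp1 : ((n + 1 : ℕ) : ℂ) ≠ 0 := Nat.cast_ne_zero.2 n.succ_ne_zero
    simp only [Nat.add_sub_cancel, hr, id]
    simp only [Pi.pow_apply, pow_succ _ n]
    push_cast at hWz hp1 ⊢
    have hWz' : (c : ℂ) * z ^ (k + m) * (n + 1) = aeval z P * aeval z Q - (n + 1) * (1 - z) *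
      (aeval z (derivative P) * aeval z Q - aeval z P * aeval z (derivative Q)) := by
      rw [← hWz]; field_simp
    have e : z ^ (k + m) * (((n : ℂ) + 1) * c *
        ((aeval z P / aeval z Q) ^ n * (aeval z Q)⁻¹ ^ 2)) =
        (c * z ^ (k + m) * (n + 1)) * ((aeval z P / aeval z Q) ^ n * (aeval z Q)⁻¹ ^ 2) := by ring
    rw [e, hWz']
    field_simp
    ring
  · have hP0 : aeval (0 : ℂ) P = 1 := by
      rw [← coeff_zero_eq_aeval_zero', coeff_zero_eq_eval_zero, hP]; simp
    simp [hr, hP0, hQz]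
  · exact (NormMajorized.const (by positivity)).mul ((hrmaj.pow (p - 1)).mul (hQinv.pow 2))
  · intro y hy0 hy1
    have hyn : ‖(y : ℂ)‖ ≤ y := by rw [Complex.norm_real, Real.norm_of_nonneg hy0.le]
    have e := (hrmaj.pow p _ _ hyn hy1).1
    simp only at e ⊢
    rw [e]
    have e2 : (1 : ℂ) - (1 - (y : ℂ)) * (‖r y ^ p‖ : ℂ) = ((1 - (1 - y) * ‖r y ^ p‖ : ℝ) : ℂ) := by
      push_cast; rfl
    rw [e2, Complex.ofReal_re]
    have : 0 ≤ (1 - y) * ‖r y ^ p‖ := mul_nonneg (by linarith) (norm_nonneg _)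
    linarith

/-! ### Order of contact with (1-z)^(-1/p) -/

lemma hasDerivAt_cpow_mul_quotient {a c : ℝ} {P Q : ℝ[X]} {N : ℕ}
    (hW : padeWronskian a P Q = C c * X ^ N) {z : ℂ} (hz : ‖z‖ < 1) (hQ : aeval z Q ≠ 0) :
    HasDerivAt (fun z : ℂ => (1 - z) ^ (a : ℂ) * (aeval z P / aeval z Q))
      (z ^ N * (-((1 - z) ^ ((a : ℂ) - 1) * c / aeval z Q ^ 2))) z := by
  have hslit : 1 - z ∈ Complex.slitPlane := by
    rw [sub_eq_add_neg]
    exact Complex.mem_slitPlane_of_norm_lt_one (by rwa [norm_neg])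
  have hne : 1 - z ≠ 0 := Complex.slitPlane_ne_zero hslit
  refine ((((hasDerivAt_id z).const_sub 1).cpow_const (c := (a : ℂ)) hslit).mul
    (hasDerivAt_aeval_div (P := P) hQ)).congr_deriv ?_
  have hWz := aeval_padeWronskian hW z
  have e : (1 - z) ^ (a : ℂ) = (1 - z) ^ ((a : ℂ) - 1) * (1 - z) := by
    rw [Complex.cpow_sub _ _ hne, Complex.cpow_one, div_mul_cancel₀ _ hne]
  have e2 : z ^ N * (-((1 - z) ^ ((a : ℂ) - 1) * c / aeval z Q ^ 2)) =
      -((1 - z) ^ ((a : ℂ) - 1) * (c * z ^ N) / aeval z Q ^ 2) := by ring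
  simp only [id]
  rw [e2, ← hWz, e]
  field_simp
  ring

/-- A Wronskian divisible by `X ^ N` forces contact of order `N + 1` with `(1 - z) ^ (-1/p)`. -/
lemma isBigO_invRoot_sub {p N : ℕ} {c : ℝ} {P Q : ℝ[X]} (hP0 : aeval (0 : ℂ) P = 1)
    (hQ0 : aeval (0 : ℂ) Q = 1) (hW : padeWronskian (1 / p) P Q = C c * X ^ N) :
    (fun z : ℂ => invRoot p z - aeval z P / aeval z Q) =O[𝓝 0] fun z : ℂ => z ^ (N + 1) := by
  set a : ℝ := 1 / p with ha
  set F : ℂ → ℂ := fun z => (1 - z) ^ (a : ℂ) * (aeval z P / aeval z Q) with hF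
  set D : ℂ → ℂ := fun z => -((1 - z) ^ ((a : ℂ) - 1) * c / aeval z Q ^ 2) with hD
  have hQc : ContinuousAt (fun z : ℂ => aeval z Q) 0 := (Q.hasDerivAt_aeval 0).continuousAt
  have hpow : ∀ b : ℂ, ContinuousAt (fun z : ℂ => (1 - z) ^ b) 0 := fun b =>
    ContinuousAt.cpow (continuousAt_const.sub continuousAt_id) continuousAt_const (by simp)
  have hDc : ContinuousAt D 0 :=
    (((hpow _).mul continuousAt_const).div (hQc.pow 2) (by simp [hQ0])).neg
  have hev : ∀ᶠ z in 𝓝 (0 : ℂ), ‖z‖ < 1 ∧ aeval z Q ≠ 0 ∧ ‖D z‖ < ‖D 0‖ + 1 := by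
    refine Filter.Eventually.and ?_ (Filter.Eventually.and ?_ ?_)
    · filter_upwards [Metric.ball_mem_nhds (0 : ℂ) one_pos] with z hz using by simpa using hz
    · exact hQc.eventually_ne (by rw [hQ0]; exact one_ne_zero)
    · exact hDc.norm.eventually_lt continuousAt_const (by linarith)
  obtain ⟨δ, hδ, hball⟩ := Metric.eventually_nhds_iff.1 hev
  have hF0 : F 0 = 1 := by simp [hF, hP0, hQ0]
  have hFO : (fun z => 1 - F z) =O[𝓝 0] fun z : ℂ => z ^ (N + 1) := by
    refine IsBigO.of_bound (‖D 0‖ + 1) ?_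
    filter_upwards [Metric.ball_mem_nhds (0 : ℂ) hδ] with z hz
    rw [Metric.mem_ball, dist_zero_right] at hz
    have hin : ∀ w ∈ Metric.closedBall (0 : ℂ) ‖z‖, ‖w‖ ≤ ‖z‖ ∧ dist w 0 < δ := fun w hw => by
      rw [Metric.mem_closedBall, dist_zero_right] at hw
      exact ⟨hw, by rw [dist_zero_right]; exact hw.trans_lt hz⟩
    -- On the disc of radius ‖z‖ the derivative w^N D(w) is at most ‖z‖^N (‖D 0‖ + 1); the mean
    -- value inequality gains one more factor ‖z‖.
    have hmv := Convex.norm_image_sub_le_of_norm_hasDerivWithin_le (f := F)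
      (f' := fun w => w ^ N * D w) (s := Metric.closedBall (0 : ℂ) ‖z‖)
      (C := ‖z‖ ^ N * (‖D 0‖ + 1)) (x := 0) (y := z)
      (fun w hw => by
        obtain ⟨h1, h2, -⟩ := hball (hin w hw).2
        exact (hasDerivAt_cpow_mul_quotient hW h1 h2).hasDerivWithinAt)
      (fun w hw => by
        obtain ⟨-, -, h3⟩ := hball (hin w hw).2
        rw [norm_mul, norm_pow]
        have := (hin w hw).1
        gcongr)
      (convex_closedBall 0 _) (by simp) (by simp)
    rw [hF0, sub_zero] at hmv
    rw [norm_sub_rev, norm_pow, pow_succ]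
    linarith
  have hbdd : (fun z : ℂ => (1 - z) ^ (-(a : ℂ))) =O[𝓝 0] fun _ : ℂ => (1 : ℂ) :=
    (hpow _).isBigO_one ℂ
  have hmul := hbdd.mul hFO
  simp only [one_mul] at hmul
  refine hmul.congr' ?_ Filter.EventuallyEq.rfl
  filter_upwards [hev] with z hz
  have hne : 1 - z ≠ 0 := by
    intro h
    have := hz.1
    rw [← sub_eq_zero.1 h, norm_one] at this
    exact lt_irrefl _ this
  have h1 : (1 - z) ^ (-(a : ℂ)) * (1 - z) ^ (a : ℂ) = 1 := by
    rw [← Complex.cpow_add _ _ hne]; simp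
  have h2 : invRoot p z = (1 - z) ^ (-(a : ℂ)) := by
    rw [invRoot, ha]; push_cast; rfl
  rw [h2, hF]
  linear_combination (-(aeval z P / aeval z Q)) * h1

/-! ### Uniqueness of the approximant -/

lemma X_pow_dvd_of_isBigO (n : ℕ) (D : ℂ[X])
    (h : (fun z : ℂ => D.eval z) =O[𝓝[≠] 0] fun z : ℂ => z ^ n) : X ^ n ∣ D := by
  induction n generalizing D with
  | zero => simp
  | succ n ih =>
    have hpow : Filter.Tendsto (fun z : ℂ => z ^ (n + 1)) (𝓝[≠] 0) (𝓝 0) := by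
      have : Filter.Tendsto (fun z : ℂ => z ^ (n + 1)) (𝓝 0) (𝓝 (0 ^ (n + 1))) :=
        (continuous_pow (n + 1)).tendsto 0
      rw [zero_pow n.succ_ne_zero] at this
      exact this.mono_left nhdsWithin_le_nhds
    have h0 : D.eval 0 = 0 := tendsto_nhds_unique
      ((D.continuous.tendsto 0).mono_left nhdsWithin_le_nhds) (h.trans_tendsto hpow)
    obtain ⟨E, rfl⟩ := X_dvd_iff.2 ((coeff_zero_eq_eval_zero D).trans h0)
    have hE : (fun z : ℂ => E.eval z) =O[𝓝[≠] 0] fun z : ℂ => z ^ n := by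
      refine ((isBigO_refl (fun z : ℂ => z⁻¹) (𝓝[≠] 0)).mul h).congr' ?_ ?_
      · filter_upwards [self_mem_nhdsWithin] with z hz
        rw [eval_mul, eval_X, inv_mul_cancel_left₀ hz]
      · filter_upwards [self_mem_nhdsWithin] with z hz
        rw [pow_succ', inv_mul_cancel_left₀ hz]
    rw [pow_succ']
    exact mul_dvd_mul_left X (ih E hE)

namespace IsPadeApproximant

variable {f : ℂ → ℂ} {k m : ℕ} {P Q P₁ Q₁ : ℂ[X]}

lemma isCoprime (h : IsPadeApproximant f k m P Q) : IsCoprime P Q := by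
  rw [isCoprime_iff_aeval_ne_zero_of_isAlgClosed ℂ ℂ]
  intro z
  have := h.no_common_zero z
  simp only [coe_aeval_eq_eval]
  tauto

/-- The difference of the cross products has degree at most `k + m` yet vanishes at 0 to order `k +
m + 1`. -/
lemma cross_mul_eq (h : IsPadeApproximant f k m P Q) (h₁ : IsPadeApproximant f k m P₁ Q₁) :
    P * Q₁ = P₁ * Q := by
  have hO := h₁.isBigO.sub h.isBigO
  have hQ : (fun z : ℂ => (Q * Q₁).eval z) =O[𝓝 0] fun _ : ℂ => (1 : ℂ) :=
    (Q * Q₁).continuous.continuousAt.isBigO_one ℂ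
  have hmul := hQ.mul hO
  have hne : ∀ q : ℂ[X], q.eval 0 = 1 → ∀ᶠ z in 𝓝 (0 : ℂ), q.eval z ≠ 0 := fun q hq =>
    q.continuous.continuousAt.eventually_ne (by rw [hq]; exact one_ne_zero)
  have hD : (fun z : ℂ => (P * Q₁ - P₁ * Q).eval z) =O[𝓝[≠] 0] fun z : ℂ => z ^ (k + m + 1) := by
    refine (hmul.congr' ?_ ?_).mono nhdsWithin_le_nhds
    · filter_upwards [hne Q h.den_eval_zero, hne Q₁ h₁.den_eval_zero] with z hz hz₁
      simp only [eval_mul, eval_sub]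
      field_simp
      ring
    · exact Filter.Eventually.of_forall fun z => one_mul _
  have hdvd := X_pow_dvd_of_isBigO _ _ hD
  refine sub_eq_zero.1 (eq_zero_of_dvd_of_natDegree_lt hdvd ?_)
  rw [natDegree_X_pow]
  refine (natDegree_sub_le_of_le
    (natDegree_mul_le_of_le h.natDegree_num_le h₁.natDegree_den_le)
    (natDegree_mul_le_of_le h₁.natDegree_num_le h.natDegree_den_le)).trans_lt ?_
  simp

lemma den_ne_zero (h : IsPadeApproximant f k m P Q) : Q ≠ 0 := fun h0 => by
  have := h.den_eval_zero
  rw [h0] at this; simp at this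

/-- Reduced normalized Padé approximants are unique. -/
lemma unique (h : IsPadeApproximant f k m P Q) (h₁ : IsPadeApproximant f k m P₁ Q₁) :
    P = P₁ ∧ Q = Q₁ := by
  have hc := h.cross_mul_eq h₁
  have d1 : Q ∣ Q₁ := h.isCoprime.symm.dvd_of_dvd_mul_left (Dvd.intro_left P₁ hc.symm)
  have d2 : Q₁ ∣ Q := h₁.isCoprime.symm.dvd_of_dvd_mul_left (Dvd.intro_left P hc)
  obtain ⟨u, hu⟩ := associated_of_dvd_dvd d1 d2
  obtain ⟨c, -, hcu⟩ := Polynomial.isUnit_iff.1 u.isUnit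
  have hQ : Q = Q₁ := by
    rw [← hcu] at hu
    have he := congrArg (eval 0) hu
    rw [eval_mul, eval_C, h.den_eval_zero, h₁.den_eval_zero, one_mul] at he
    rw [← hu, he, C_1, mul_one]
  refine ⟨?_, hQ⟩
  rw [hQ] at hc
  exact mul_right_cancel₀ h₁.den_ne_zero hc

end IsPadeApproximant

/-! ### Existence and the iteration -/

/-- Existence of the Padé approximant, together with its contraction property. -/
lemma exists_isPadeApproximant_invRoot {p k m : ℕ} (hp : 2 ≤ p) (hkm : m ≤ k + 1) :
    ∃ P Q : ℂ[X], IsPadeApproximant (invRoot p) k m P Q ∧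
      ∀ z : ℂ, ‖z‖ < 1 → Q.eval z ≠ 0 ∧
        ‖1 - (1 - z) * (P.eval z / Q.eval z) ^ p‖ ≤ ‖z‖ ^ (k + m + 1) := by
  have hp2 : (2 : ℝ) ≤ p := by exact_mod_cast hp
  have ha : 0 < 1 / (p : ℝ) := by positivity
  have ha1 : 1 / (p : ℝ) < 1 := by rw [div_lt_one (by linarith)]; linarith
  obtain ⟨c, hc, hW⟩ := exists_padeWronskian_eq ha ha1 hkm
  obtain ⟨T, hTc, hT, hfac⟩ := exists_factorization_den ha ha1 hkm
  set P := hypPoly (k + m) (m - 1 / p) k with hPdef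
  set Q := hypPoly (k + m) (k + 1 / p) m with hQdef
  have hP0 : P.eval 0 = 1 := eval_zero_hypPoly _ _ _
  have hQ0 : Q.eval 0 = 1 := eval_zero_hypPoly _ _ _
  have hzero : ∀ q : ℝ[X], q.eval 0 = 1 → aeval (0 : ℂ) q = 1 := fun q hq => by
    rw [← coeff_zero_eq_aeval_zero', coeff_zero_eq_eval_zero, hq]; simp
  refine ⟨P.map (algebraMap ℝ ℂ), Q.map (algebraMap ℝ ℂ), ⟨?_, ?_, ?_, ?_, ?_⟩, ?_⟩
  · exact natDegree_map_le.trans (natDegree_hypPoly_le _ _ _)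
  · exact natDegree_map_le.trans (natDegree_hypPoly_le _ _ _)
  · rw [eval_map_algebraMap, hzero Q hQ0]
  · rintro z ⟨h1, h2⟩
    rw [eval_map_algebraMap] at h1 h2
    have h := aeval_padeWronskian hW z
    rw [h1, h2] at h
    have hz : z ^ (k + m) = 0 := by
      have hcz : (c : ℂ) * z ^ (k + m) = 0 := by rw [← h]; ring
      exact (mul_eq_zero.1 hcz).resolve_left (by exact_mod_cast hc.ne')
    rw [eq_zero_of_pow_eq_zero hz, hzero Q hQ0] at h2
    exact one_ne_zero h2
  · simp only [eval_map_algebraMap]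
    exact isBigO_invRoot_sub (hzero P hP0) (hzero Q hQ0) hW
  · intro z hz
    simp only [eval_map_algebraMap]
    rw [hfac] at hW ⊢
    exact norm_residual_le hp hc hkm T hTc hT hP0 (natDegree_hypPoly_le _ _ _) hW hz

theorem mainTheorem1 (p k m : ℕ) (hp : 2 ≤ p) (hkm : m ≤ k + 1) :
    (∃! PQ : ℂ[X] × ℂ[X], IsPadeApproximant (invRoot p) k m PQ.1 PQ.2) ∧
    ∀ P Q : ℂ[X], IsPadeApproximant (invRoot p) k m P Q →
      ∀ x : ℕ → ℂ, ‖1 - x 0 ^ p‖ < 1 → (∀ l : ℕ, x (l + 1) = padeStep p P Q (x l)) →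
        ∀ l : ℕ, Q.eval (1 - x l ^ p) ≠ 0 ∧
          ‖1 - x l ^ p‖ ≤ ‖1 - x 0 ^ p‖ ^ ((k + m + 1) ^ l) := by
  obtain ⟨P₀, Q₀, h₀, hres⟩ := exists_isPadeApproximant_invRoot hp hkm
  refine ⟨⟨(P₀, Q₀), h₀, fun PQ h => Prod.ext (h.unique h₀).1 (h.unique h₀).2⟩, ?_⟩
  intro P Q h x hx0 hx
  obtain ⟨rfl, rfl⟩ := h.unique h₀
  have hbound : ∀ l : ℕ, ‖1 - x l ^ p‖ ≤ ‖1 - x 0 ^ p‖ ^ ((k + m + 1) ^ l) := by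
    intro l
    induction l with
    | zero => simp
    | succ l ih =>
      have hlt : ‖1 - x l ^ p‖ < 1 := ih.trans_lt (pow_lt_one₀ (norm_nonneg _) hx0 (by positivity))
      have hstep := (hres _ hlt).2
      -- For z = 1 - x_l^p the factor 1 - z is x_l^p, so the residual at z is 1 - x_{l+1}^p.
      rw [sub_sub_cancel, ← mul_pow] at hstep
      rw [hx l, padeStep, pow_succ (k + m + 1) l, pow_mul]
      exact hstep.trans (pow_le_pow_left₀ (norm_nonneg _) ih _)
  intro l
  exact ⟨(hres _ ((hbound l).trans_lt
    (pow_lt_one₀ (norm_nonneg _) hx0 (by positivity)))).1, hbound l⟩
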